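/- Let $G$ be a connected locally compact (Hausdorff) group with a left Haar measure $\mu$ and a right Haar measure $\nu$. For compact sets $A,B\subseteq G$ of positive measure, let $\mathrm{BM}(A,B)$ denote the real number $r>0$ such that \[ \left(\frac{\nu(A)}{\nu(AB)}\right)^{1/r}+\left(\frac{\mu(B)}{\mu(AB)}\right)^{1/r}=1 , \] where $AB=\{ab: a\in A,\ b\in B\}$, and let $\mathrm{BM}(G)$ be the largest real number $r\ge 0$ such that $\mathrm{BM}(A,B)\ge r$ for all compact $A,B\subseteq G$ of positive measure. Suppose that $G$ is not unimodular (that is, $\mu$ is not right invariant) and that $\mathrm{BM}(G)=2$. Then every compact set $A\subseteq G$ of positive measure satisfies, with $A^2=AA$, \[ \left(\frac{\nu(A)}{\nu(A^2)}\right)^{1/2}+\left(\frac{\mu(A)}{\mu(A^2)}\right)^{1/2}<1 . \] -/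

import Mathlib

open MeasureTheory
open scoped Pointwise

/-- `r` is the Brunn–Minkowski coefficient `BM(A, B)` of the pair `(A, B)`, where `μ` is a left and
`ν` a right Haar measure: `(ν(A)/ν(AB))^{1/r} + (μ(B)/μ(AB))^{1/r} = 1`. (The exponent `1/r` makes
sense for `r > 0` only.) -/
def IsPairBMCoeff {G : Type*} [Group G] [MeasurableSpace G] (μ ν : Measure G) (A B : Set G)
    (r : ℝ) : Prop :=
  0 < r ∧ (ν.real A / ν.real (A * B)) ^ (1 / r) + (μ.real B / μ.real (A * B)) ^ (1 / r) = 1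

/-- `r` is the Brunn–Minkowski coefficient `BM(G)` of the group `G`, where `μ` is a left and `ν` a
right Haar measure: the largest real number `r ≥ 0` such that `BM(A, B) ≥ r` for all compact sets
`A, B` of positive measure (for null sets the equation defining `BM(A, B)` may hold for every `r`,
or for none). -/
def IsGroupBMCoeff {G : Type*} [Group G] [TopologicalSpace G] [MeasurableSpace G]
    (μ ν : Measure G) (r : ℝ) : Prop :=
  IsGreatest {s : ℝ | 0 ≤ s ∧ ∀ A B : Set G, IsCompact A → IsCompact B → 0 < ν A → 0 < μ B →
    ∃ t : ℝ, IsPairBMCoeff μ ν A B t ∧ s ≤ t} r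

/-! Let `Δ` be the modular function. Cut `A` at a level `a` of `Δ` into two halves of equal
`ν`-measure, and `B` at a level `b` into two halves of equal `μ`-measure. Since `Δ` is
multiplicative, the product `P` of the lower halves lies in `Δ ≤ ab` and the product `Q` of the
upper halves in `Δ ≥ ab`. Level sets are null, so the measures of `P` and `Q` add up to at most
those of `AB`. Averaging the inequality with exponent `1/2` over the two pairs of halves gives it
for `(A, B)`, strictly unless `P` and `Q` agree in both measures (`sqrt_div_add_sqrt_div_lt_one`).
They cannot: `ν` is proportional to `Δ μ`, so the ratio `ν/μ` is strictly smaller on `P` than on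
`Q`. -/

open Measure Set Filter Topology
open scoped NNReal ENNReal

/-! ### Strict convexity behind the halving argument -/

section ElementaryInequality

/-- The power mean of order `-2` is at most the arithmetic mean. -/
lemma sqrt_div_add_le {a N₁ N₂ : ℝ} (ha : 0 < a) (h₁ : 0 < N₁) (h₂ : 0 < N₂) :
    √(a / (N₁ + N₂)) ≤ (√(a / 2 / N₁) + √(a / 2 / N₂)) / 2 ∧
      (N₁ ≠ N₂ → √(a / (N₁ + N₂)) < (√(a / 2 / N₁) + √(a / 2 / N₂)) / 2) := by
  have hx₀ : 0 < √(a / 2 / N₁) := by positivity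
  have hy₀ : 0 < √(a / 2 / N₂) := by positivity
  have hx₂ : √(a / 2 / N₁) ^ 2 = a / 2 / N₁ := Real.sq_sqrt (by positivity)
  have hy₂ : √(a / 2 / N₂) ^ 2 = a / 2 / N₂ := Real.sq_sqrt (by positivity)
  generalize √(a / 2 / N₁) = x at *
  generalize √(a / 2 / N₂) = y at *
  have hN₁ : N₁ = a / 2 / x ^ 2 := by rw [hx₂]; field_simp
  have hN₂ : N₂ = a / 2 / y ^ 2 := by rw [hy₂]; field_simp
  have key : a / (N₁ + N₂) = 2 * x ^ 2 * y ^ 2 / (x ^ 2 + y ^ 2) := by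
    rw [hN₁, hN₂]; field_simp; ring
  have hxy : 0 < x * y := by positivity
  -- The factor `(x - y) ^ 2` yields both the inequality and its equality case.
  have hid : ((x + y) / 2) ^ 2 * (x ^ 2 + y ^ 2) - 2 * x ^ 2 * y ^ 2
      = (x - y) ^ 2 * ((x ^ 2 + y ^ 2 + 4 * (x * y)) / 4) := by ring
  have hc : 0 < (x ^ 2 + y ^ 2 + 4 * (x * y)) / 4 := by positivity
  constructor
  · rw [key, Real.sqrt_le_left (by positivity), div_le_iff₀ (by positivity)]
    have := mul_nonneg (sq_nonneg (x - y)) hc.le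
    linarith
  · intro hne
    have hxy' : x - y ≠ 0 := by
      intro h
      exact hne (by rw [hN₁, hN₂, sub_eq_zero.mp h])
    rw [key, Real.sqrt_lt' (by positivity), div_lt_iff₀ (by positivity)]
    have := mul_pos (by positivity : 0 < (x - y) ^ 2) hc
    linarith

lemma sqrt_div_add_sqrt_div_lt_one {a b N M N₁ N₂ M₁ M₂ : ℝ} (ha : 0 < a) (hb : 0 < b)
    (hN₁ : 0 < N₁) (hN₂ : 0 < N₂) (hM₁ : 0 < M₁) (hM₂ : 0 < M₂)
    (hN : N₁ + N₂ ≤ N) (hM : M₁ + M₂ ≤ M)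
    (h₁ : √(a / 2 / N₁) + √(b / 2 / M₁) ≤ 1) (h₂ : √(a / 2 / N₂) + √(b / 2 / M₂) ≤ 1)
    (hne : ¬ (N₁ = N₂ ∧ M₁ = M₂)) :
    √(a / N) + √(b / M) < 1 := by
  have hN' : √(a / N) ≤ √(a / (N₁ + N₂)) := by gcongr
  have hM' : √(b / M) ≤ √(b / (M₁ + M₂)) := by gcongr
  obtain ⟨hn, hn'⟩ := sqrt_div_add_le ha hN₁ hN₂
  obtain ⟨hm, hm'⟩ := sqrt_div_add_le hb hM₁ hM₂
  by_cases h : N₁ = N₂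
  · have := hm' fun h' ↦ hne ⟨h, h'⟩
    linarith
  · have := hn' h
    linarith

end ElementaryInequality

/-- A measure which does not charge the level sets of `f` can be split in two equal parts
along one of them. -/
lemma exists_measureReal_level_eq_half {X : Type*} [TopologicalSpace X] [MeasurableSpace X]
    [OpensMeasurableSpace X] [T2Space X] (m : Measure X) [IsFiniteMeasureOnCompacts m]
    {f : X → ℝ} (hf : Continuous f) {A : Set X} (hA : IsCompact A)
    (h₀ : ∀ c, m (A ∩ f ⁻¹' {c}) = 0) :
    ∃ c, m.real (A ∩ {x | f x ≤ c}) = m.real A / 2 ∧ m.real (A ∩ {x | c ≤ f x}) = m.real A / 2 := by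
  have : IsFiniteMeasure (m.restrict A) := ⟨by simpa using hA.measure_lt_top⟩
  set ρ : Measure ℝ := (m.restrict A).map f with hρ
  have happ : ∀ s, MeasurableSet s → ρ.real s = m.real (A ∩ f ⁻¹' s) := by
    intro s hs
    rw [hρ, map_measureReal_apply hf.measurable hs,
      measureReal_restrict_apply (hf.measurable hs), inter_comm]
  have : NullSingletonClass ρ := ⟨fun c ↦ by
    rw [hρ, Measure.map_apply hf.measurable (measurableSet_singleton c),
      Measure.restrict_apply (hf.measurable (measurableSet_singleton c)), inter_comm, h₀]⟩
  obtain ⟨a, ha⟩ := (hA.image hf).bddBelow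
  obtain ⟨b, hb⟩ := (hA.image hf).bddAbove
  -- Shifting by `1` lets the half-open interval `(a - 1, t]` catch the minimum of `f`; `max b a`
  -- keeps the interval ordered even for empty `A`.
  replace ha : ∀ x ∈ A, a - 1 < f x := fun x hx ↦ by
    have := ha (mem_image_of_mem f hx); linarith
  replace hb : ∀ x ∈ A, f x ≤ max b a := fun x hx ↦
    (hb (mem_image_of_mem f hx)).trans (le_max_left _ _)
  have hab : a - 1 ≤ max b a := by linarith [le_max_right b a]
  have hcont : Continuous fun t ↦ ∫ _ in (a - 1)..t, (1 : ℝ) ∂ρ :=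
    intervalIntegral.continuous_primitive
      (fun _ _ ↦ ⟨(integrable_const _).integrableOn, (integrable_const _).integrableOn⟩) _
  have hF : ∀ t, a - 1 ≤ t → ∫ _ in (a - 1)..t, (1 : ℝ) ∂ρ = m.real (A ∩ {x | f x ≤ t}) := by
    intro t ht
    rw [intervalIntegral.integral_of_le ht, setIntegral_const, smul_eq_mul, mul_one,
      happ _ measurableSet_Ioc]
    congr 1
    ext x
    simp only [mem_inter_iff, mem_preimage, mem_Ioc, mem_ofPred_eq]
    exact ⟨fun h ↦ ⟨h.1, h.2.2⟩, fun h ↦ ⟨h.1, ha x h.1, h.2⟩⟩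
  have htop : A ∩ {x | f x ≤ max b a} = A := inter_eq_left.mpr hb
  obtain ⟨c, hc, hc'⟩ := intermediate_value_Icc hab hcont.continuousOn
    (show m.real A / 2 ∈ _ by
      rw [intervalIntegral.integral_same, hF _ hab, htop]
      constructor <;> linarith [measureReal_nonneg (μ := m) (s := A)])
  have hle : m.real (A ∩ {x | f x ≤ c}) = m.real A / 2 := by rw [← hF c hc.1]; exact hc'
  refine ⟨c, hle, ?_⟩
  have e₁ : m.real (A ∩ {x | f x ≤ c}) = ρ.real (Iic c) := (happ _ measurableSet_Iic).symm
  have e₂ : m.real (A ∩ {x | c ≤ f x}) = ρ.real (Ici c) := (happ _ measurableSet_Ici).symm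
  have e₃ : ρ.real (Ici c) = ρ.real (Ioi c) := measureReal_congr Ioi_ae_eq_Ici.symm
  have e₄ : m.real A = ρ.real univ := by rw [happ _ MeasurableSet.univ]; simp
  have e₅ := measureReal_add_measureReal_compl (μ := ρ) (measurableSet_Iic (a := c))
  rw [compl_Iic] at e₅
  rw [e₂, e₃]
  linarith

/-! ### The modular function and Haar measures -/

section Group

variable {G : Type*} [Group G] [TopologicalSpace G] [IsTopologicalGroup G] [LocallyCompactSpace G]

/-- A connected locally compact group is `σ`-compact. -/
lemma sigmaCompactSpace_of_connectedSpace [ConnectedSpace G] : SigmaCompactSpace G := by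
  obtain ⟨V, hV, hV₁⟩ := exists_compact_mem_nhds (1 : G)
  set W := V ∪ V⁻¹ with hWdef
  have hW : IsCompact W := hV.union hV.inv
  have hW₁ : W ∈ 𝓝 (1 : G) := mem_of_superset hV₁ subset_union_left
  have hWinv : W⁻¹ = W := by rw [hWdef, union_inv, inv_inv, union_comm]
  have hpow : ∀ n : ℕ, IsCompact (W ^ n) := by
    intro n
    induction n with
    | zero => simp
    | succ n ih => rw [pow_succ]; exact ih.mul hW
  set S : Set G := ⋃ n : ℕ, W ^ n with hS
  have hmul : ∀ x ∈ S, ∀ w ∈ W, x * w ∈ S := by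
    intro x hx w hw
    obtain ⟨n, hn⟩ := mem_iUnion.mp hx
    exact mem_iUnion.mpr ⟨n + 1, by rw [pow_succ]; exact mul_mem_mul hn hw⟩
  have hnhds : ∀ x : G, (fun y ↦ x⁻¹ * y) ⁻¹' W ∈ 𝓝 x := fun x ↦
    (continuous_const_mul x⁻¹).continuousAt.preimage_mem_nhds (by simpa using hW₁)
  have hopen : IsOpen S := isOpen_iff_mem_nhds.mpr fun x hx ↦
    mem_of_superset (hnhds x) fun y hy ↦ by simpa using hmul x hx _ hy
  -- Symmetry of `W` allows stepping back from a nearby point of `S` to `x`.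
  have hclosed : IsClosed S := by
    refine isClosed_of_closure_subset fun x hx ↦ ?_
    obtain ⟨y, hy, hyS⟩ := mem_closure_iff_nhds.mp hx _ (hnhds x)
    have : (x⁻¹ * y)⁻¹ ∈ W := by rw [← hWinv]; simpa using hy
    simpa using hmul y hyS _ this
  have huniv : S = univ := IsClopen.eq_univ ⟨hclosed, hopen⟩ ⟨1, mem_iUnion.mpr ⟨0, by simp⟩⟩
  exact isSigmaCompact_univ_iff.mp ⟨fun n ↦ W ^ n, hpow, huniv⟩

lemma continuous_modularCharacterFun : Continuous (modularCharacterFun : G → ℝ≥0) := by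
  borelize G
  set μ : Measure G := haar
  obtain ⟨⟨f, hf⟩, hfc, hf₀, hf₁⟩ :
    ∃ f : C(G, ℝ), HasCompactSupport f ∧ 0 ≤ f ∧ f 1 ≠ 0 := exists_continuous_nonneg_pos 1
  have hint : ∫ x, f x ∂μ ≠ 0 :=
    (hf.integral_pos_of_hasCompactSupport_nonneg_nonzero hfc hf₀ hf₁).ne'
  refine continuous_induced_rng.mpr ?_
  -- Substituting `x = y⁻¹` in `∫ f (x * g) ∂μ` gives a convolution, which is continuous in `g`.
  have heq : (fun g : G ↦ (modularCharacterFun g : ℝ)) =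
      fun g ↦ (∫ y, f (y⁻¹ * g) ∂μ.inv) / ∫ x, f x ∂μ := by
    ext g
    rw [modularCharacterFun_eq_haarScalarFactor μ g,
      haarScalarFactor_eq_integral_div _ _ hf hfc hint,
      integral_map (measurable_mul_const g).aemeasurable hf.aestronglyMeasurable,
      Measure.inv, integral_map measurable_inv.aemeasurable
        (by fun_prop : Continuous fun y ↦ f (y⁻¹ * g)).aestronglyMeasurable]
    simp
  change Continuous fun g : G ↦ (modularCharacterFun g : ℝ)
  rw [heq]
  exact (continuous_integral_apply_inv_mul hf hfc).div_const _

variable [MeasurableSpace G] [BorelSpace G]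

/-- Without regularity, uniqueness of Haar measure gives this on sets with compact closure; a
compact exhaustion extends it to all Borel sets. -/
lemma map_mul_right_eq_modularCharacterFun_smul_of_sigmaCompactSpace [SigmaCompactSpace G]
    [T2Space G] (μ : Measure G) [μ.IsHaarMeasure] (g : G) :
    μ.map (· * g) = modularCharacterFun g • μ := by
  ext s hs
  have hmono : Monotone fun n ↦ s ∩ compactCovering G n := fun m n hmn ↦
    inter_subset_inter_right _ (compactCovering_subset G hmn)
  have hs' : s = ⋃ n, s ∩ compactCovering G n := by
    rw [← inter_iUnion, iUnion_compactCovering, inter_univ]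
  rw [hs', hmono.measure_iUnion, hmono.measure_iUnion]
  congr 1
  ext n : 1
  rw [modularCharacterFun_eq_haarScalarFactor μ g]
  exact measure_isMulInvariant_eq_smul_of_isCompact_closure _ _
    ((isCompact_compactCovering G n).closure_of_subset inter_subset_right)

/-- The measure with density the modular function with respect to a left Haar measure is right
invariant. -/
lemma isMulRightInvariant_withDensity_modularCharacterFun [SigmaCompactSpace G] [T2Space G]
    (μ : Measure G) [μ.IsHaarMeasure] :
    (μ.withDensity fun x ↦ (modularCharacterFun x : ℝ≥0∞)).IsMulRightInvariant := by
  refine ⟨fun g ↦ ?_⟩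
  have hΔ : Measurable fun x : G ↦ (modularCharacterFun x : ℝ≥0∞) :=
    continuous_modularCharacterFun.measurable.coe_nnreal_ennreal
  have hg₀ : (modularCharacterFun g : ℝ≥0∞) ≠ 0 := by
    simpa using (modularCharacterFun_pos g).ne'
  ext s hs
  have hms : MeasurableSet ((· * g) ⁻¹' s) := measurable_mul_const g hs
  rw [Measure.map_apply (measurable_mul_const g) hs, withDensity_apply _ hms,
    withDensity_apply _ hs]
  -- Both sides of this change of variables carry a factor `Δ(g)`, which cancels.
  have h := setLIntegral_map (μ := μ) hs hΔ (measurable_mul_const g)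
  rw [map_mul_right_eq_modularCharacterFun_smul_of_sigmaCompactSpace μ g] at h
  have h₁ : ∫⁻ x in s, (modularCharacterFun x : ℝ≥0∞) ∂(modularCharacterFun g • μ) =
      modularCharacterFun g * ∫⁻ x in s, (modularCharacterFun x : ℝ≥0∞) ∂μ := by
    rw [Measure.restrict_smul, lintegral_smul_measure]; rfl
  have h₂ : ∫⁻ x in (· * g) ⁻¹' s, (modularCharacterFun (x * g) : ℝ≥0∞) ∂μ =
      modularCharacterFun g * ∫⁻ x in (· * g) ⁻¹' s, (modularCharacterFun x : ℝ≥0∞) ∂μ := by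
    rw [← lintegral_const_mul _ hΔ]
    simp only [modularCharacterFun_map_mul, ENNReal.coe_mul, mul_comm]
  rw [h₁, h₂] at h
  exact ((ENNReal.mul_right_inj hg₀ ENNReal.coe_ne_top).mp h).symm

/-- A right Haar measure is, on compact sets, proportional to the measure with density the modular
function with respect to a left Haar measure. -/
lemma exists_withDensity_modularCharacterFun_eq_smul [SigmaCompactSpace G] [T2Space G]
    (μ ν : Measure G) [μ.IsHaarMeasure] [ν.IsMulRightInvariant] [IsFiniteMeasureOnCompacts ν]
    [ν.IsOpenPosMeasure] :
    ∃ k : ℝ≥0, ∀ s : Set G, IsCompact s →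
      μ.withDensity (fun x ↦ (modularCharacterFun x : ℝ≥0∞)) s = k * ν s := by
  set ν' := μ.withDensity (fun x ↦ (modularCharacterFun x : ℝ≥0∞))
  have : ν'.IsMulRightInvariant := isMulRightInvariant_withDensity_modularCharacterFun μ
  have : IsLocallyFiniteMeasure ν' :=
    IsLocallyFiniteMeasure.withDensity_coe continuous_modularCharacterFun
  -- Inversion turns right Haar measures into left ones, where uniqueness applies.
  have : ν.inv.IsHaarMeasure := {}
  refine ⟨haarScalarFactor ν'.inv ν.inv, fun s hs ↦ ?_⟩
  have h := measure_isMulInvariant_eq_smul_of_isCompact_closure ν'.inv ν.inv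
    (s := s⁻¹) hs.inv.closure
  rwa [Measure.inv_apply, Measure.inv_apply, inv_inv, ENNReal.smul_def, smul_eq_mul] at h

/-- In a connected group which is not unimodular, compact subsets of the level sets of the modular
function are null sets. -/
lemma measure_eq_zero_of_modularCharacterFun_eq [ConnectedSpace G] [T2Space G]
    (μ : Measure G) [μ.IsHaarMeasure] (hG : ¬ μ.IsMulRightInvariant) {K : Set G} (hK : IsCompact K)
    {c : ℝ} (hc : ∀ x ∈ K, (modularCharacterFun x : ℝ) = c) : μ K = 0 := by
  have := sigmaCompactSpace_of_connectedSpace (G := G)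
  by_contra hpos
  have hKhaar : (haar : Measure G) K ≠ 0 := by
    intro h
    rw [measure_isMulInvariant_eq_smul_of_isCompact_closure μ haar hK.closure, h, smul_zero] at hpos
    exact hpos rfl
  -- Steinhaus: `K / K` is a neighbourhood of `1` inside the kernel of `Δ`. The kernel is then open,
  -- hence all of `G` by connectedness, and `G` would be unimodular.
  have hnhds := div_mem_nhds_one_of_haar_pos_ne_top (haar : Measure G) K hK.measurableSet
    (pos_iff_ne_zero.mpr hKhaar) hK.measure_lt_top.ne
  set H : Subgroup G := (modularCharacter (G := G)).ker with hH
  have hmem : ∀ x, x ∈ H ↔ modularCharacterFun x = 1 := fun x ↦ MonoidHom.mem_ker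
  have hsub : K / K ⊆ (H : Set G) := by
    rintro _ ⟨x, hx, y, hy, rfl⟩
    have hxy : modularCharacterFun x = modularCharacterFun y :=
      NNReal.coe_injective ((hc x hx).trans (hc y hy).symm)
    have h : modularCharacterFun (x / y) * modularCharacterFun y = modularCharacterFun y := by
      rw [← modularCharacterFun_map_mul, div_mul_cancel, hxy]
    exact (hmem _).mpr ((mul_eq_right₀ (modularCharacterFun_pos y).ne').mp h)
  have hopen : IsOpen (H : Set G) := H.isOpen_of_mem_nhds (mem_of_superset hnhds hsub)
  have huniv : (H : Set G) = univ :=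
    IsClopen.eq_univ ⟨H.isClosed_of_isOpen hopen, hopen⟩ ⟨1, H.one_mem⟩
  refine hG ⟨fun g ↦ ?_⟩
  rw [map_mul_right_eq_modularCharacterFun_smul_of_sigmaCompactSpace μ g,
    (hmem g).mp (huniv ▸ mem_univ g : g ∈ (H : Set G)), one_smul]

end Group

/-! ### Strict integral bounds from null level sets -/

section SetIntegral

variable {X : Type*} [TopologicalSpace X] [MeasurableSpace X] [OpensMeasurableSpace X] [T2Space X]
  {m : Measure X} [IsFiniteMeasureOnCompacts m] {f : X → ℝ} {S : Set X} {c : ℝ}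

lemma setIntegral_pos_of_nonneg_of_measure_zero_set (hf : Continuous f) (hS : IsCompact S)
    (h₀ : m (S ∩ f ⁻¹' {0}) = 0) (hpos : m S ≠ 0) (hle : ∀ x ∈ S, 0 ≤ f x) :
    0 < ∫ x in S, f x ∂m := by
  rw [setIntegral_pos_iff_support_of_nonneg_ae
    ((ae_restrict_iff' hS.measurableSet).mpr (ae_of_all _ hle))
    (hf.continuousOn.integrableOn_compact hS)]
  refine pos_iff_ne_zero.mpr fun h ↦
    hpos (measure_mono_null (fun x hx ↦ ?_) (measure_union_null h₀ h))
  by_cases hfx : f x = 0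
  · exact Or.inl ⟨hx, hfx⟩
  · exact Or.inr ⟨hfx, hx⟩

lemma setIntegral_lt_mul_measureReal (hf : Continuous f) (hS : IsCompact S)
    (h₀ : m (S ∩ f ⁻¹' {c}) = 0) (hpos : m S ≠ 0) (hle : ∀ x ∈ S, f x ≤ c) :
    ∫ x in S, f x ∂m < c * m.real S := by
  have h := setIntegral_pos_of_nonneg_of_measure_zero_set (m := m) (f := fun x ↦ c - f x)
    (by fun_prop) hS (by convert h₀ using 3; ext x; simp [sub_eq_zero, eq_comm]) hpos
    fun x hx ↦ sub_nonneg.mpr (hle x hx)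
  rw [integral_sub (continuousOn_const.integrableOn_compact hS)
    (hf.continuousOn.integrableOn_compact hS), setIntegral_const, smul_eq_mul] at h
  linarith

lemma mul_measureReal_lt_setIntegral (hf : Continuous f) (hS : IsCompact S)
    (h₀ : m (S ∩ f ⁻¹' {c}) = 0) (hpos : m S ≠ 0) (hle : ∀ x ∈ S, c ≤ f x) :
    c * m.real S < ∫ x in S, f x ∂m := by
  have h := setIntegral_pos_of_nonneg_of_measure_zero_set (m := m) (f := fun x ↦ f x - c)
    (by fun_prop) hS (by convert h₀ using 3; ext x; simp [sub_eq_zero]) hpos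
    fun x hx ↦ sub_nonneg.mpr (hle x hx)
  rw [integral_sub (hf.continuousOn.integrableOn_compact hS)
    (continuousOn_const.integrableOn_compact hS), setIntegral_const, smul_eq_mul] at h
  linarith

end SetIntegral

/-! ### The Brunn–Minkowski inequality and its strictness -/

section BrunnMinkowski

variable {G : Type*} [Group G] [TopologicalSpace G] [IsTopologicalGroup G]
  [MeasurableSpace G] [BorelSpace G]

/-- The Brunn–Minkowski inequality with exponent `1 / s` for a pair of sets with coefficient at
least `s`. -/
lemma IsPairBMCoeff.rpow_add_rpow_le_one {μ ν : Measure G} [μ.IsMulLeftInvariant]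
    [IsFiniteMeasureOnCompacts μ] [ν.IsMulRightInvariant] [IsFiniteMeasureOnCompacts ν]
    {A B : Set G} (hA : IsCompact A) (hB : IsCompact B) (hA₀ : A.Nonempty) (hB₀ : B.Nonempty)
    {s t : ℝ} (ht : IsPairBMCoeff μ ν A B t) (hs : 0 < s) (hst : s ≤ t) :
    (ν.real A / ν.real (A * B)) ^ (1 / s) + (μ.real B / μ.real (A * B)) ^ (1 / s) ≤ 1 := by
  obtain ⟨ht₀, ht⟩ := ht
  obtain ⟨a, ha⟩ := hA₀
  obtain ⟨b, hb⟩ := hB₀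
  have hν : ν.real A ≤ ν.real (A * B) := by
    have h : ν.real A ≤ ν.real ((· * b⁻¹) ⁻¹' A) := by
      rw [Measure.real, Measure.real, measure_preimage_mul_right]
    refine h.trans (measureReal_mono (fun x hx ↦ ?_) (hA.mul hB).measure_lt_top.ne)
    exact ⟨x * b⁻¹, hx, b, hb, inv_mul_cancel_right x b⟩
  have hμ : μ.real B ≤ μ.real (A * B) := by
    have h : μ.real B ≤ μ.real ((a⁻¹ * ·) ⁻¹' B) := by
      rw [Measure.real, Measure.real, measure_preimage_mul]
    refine h.trans (measureReal_mono (fun x hx ↦ ?_) (hA.mul hB).measure_lt_top.ne)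
    exact ⟨a, ha, a⁻¹ * x, hx, mul_inv_cancel_left a x⟩
  -- Both ratios are at most `1`, so the larger exponent only lowers the powers.
  have hexp : 1 / t ≤ 1 / s := one_div_le_one_div_of_le hs hst
  refine le_trans (add_le_add ?_ ?_) ht.le
  · exact Real.rpow_le_rpow_of_exponent_ge' (by positivity)
      (div_le_one_of_le₀ hν measureReal_nonneg) (by positivity) hexp
  · exact Real.rpow_le_rpow_of_exponent_ge' (by positivity)
      (div_le_one_of_le₀ hμ measureReal_nonneg) (by positivity) hexp

variable [T2Space G] [LocallyCompactSpace G]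

lemma exists_setIntegral_modularCharacterFun_eq_mul [SigmaCompactSpace G]
    (μ ν : Measure G) [μ.IsHaarMeasure] [ν.IsMulRightInvariant] [IsFiniteMeasureOnCompacts ν]
    [ν.IsOpenPosMeasure] :
    ∃ k : ℝ, 0 ≤ k ∧ ∀ s : Set G, IsCompact s →
      ∫ x in s, (modularCharacterFun x : ℝ) ∂μ = k * ν.real s := by
  obtain ⟨k, hk⟩ := exists_withDensity_modularCharacterFun_eq_smul μ ν
  refine ⟨k, k.2, fun s hs ↦ ?_⟩
  have h := congrArg ENNReal.toReal (hk s hs)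
  rw [withDensity_apply _ hs.measurableSet, ENNReal.toReal_mul, ENNReal.coe_toReal] at h
  rw [Measure.real, ← h,
    integral_eq_lintegral_of_nonneg_ae (ae_of_all _ fun x ↦ NNReal.coe_nonneg _)
      (NNReal.continuous_coe.comp continuous_modularCharacterFun).aestronglyMeasurable]
  simp

/-- In a connected group which is not unimodular, if the Brunn–Minkowski inequality with exponent
`1 / 2` holds for all pairs of compact sets, then it is always strict. -/
theorem sqrt_add_sqrt_lt_one_of_not_isMulRightInvariant [ConnectedSpace G]
    (μ ν : Measure G) [μ.IsHaarMeasure] [ν.IsMulRightInvariant] [IsFiniteMeasureOnCompacts ν]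
    [ν.IsOpenPosMeasure] (hG : ¬ μ.IsMulRightInvariant)
    (hBM : ∀ A B : Set G, IsCompact A → IsCompact B → 0 < ν A → 0 < μ B →
      √(ν.real A / ν.real (A * B)) + √(μ.real B / μ.real (A * B)) ≤ 1)
    {A B : Set G} (hA : IsCompact A) (hB : IsCompact B) (hμA : 0 < μ A) (hμB : 0 < μ B) :
    √(ν.real A / ν.real (A * B)) + √(μ.real B / μ.real (A * B)) < 1 := by
  have := sigmaCompactSpace_of_connectedSpace (G := G)
  set Δ : G → ℝ := fun x ↦ (modularCharacterFun x : ℝ) with hΔ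
  have hΔc : Continuous Δ := NNReal.continuous_coe.comp continuous_modularCharacterFun
  have hΔpos : ∀ x, 0 < Δ x := fun x ↦ NNReal.coe_pos.mpr (modularCharacterFun_pos x)
  have hΔmul : ∀ x y, Δ (x * y) = Δ x * Δ y := fun x y ↦ by
    simp only [hΔ, modularCharacterFun_map_mul, NNReal.coe_mul]
  obtain ⟨k, hk₀, hk⟩ : ∃ k : ℝ, 0 ≤ k ∧ ∀ s : Set G, IsCompact s →
      ∫ x in s, Δ x ∂μ = k * ν.real s := exists_setIntegral_modularCharacterFun_eq_mul μ ν
  have hlevel : ∀ {K : Set G}, IsCompact K → ∀ c, μ (K ∩ Δ ⁻¹' {c}) = 0 := fun {K} hK c ↦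
    measure_eq_zero_of_modularCharacterFun_eq μ hG
      (hK.inter_right (isClosed_singleton.preimage hΔc)) fun x hx ↦ hx.2
  have hpos : ∀ {S : Set G}, IsCompact S → 0 < μ S → 0 < k * ν.real S := fun {S} hS hμS ↦ by
    rw [← hk S hS]
    exact setIntegral_pos_of_nonneg_of_measure_zero_set hΔc hS (hlevel hS 0) hμS.ne'
      fun x _ ↦ (hΔpos x).le
  have hkpos : 0 < k := pos_of_mul_pos_left (hpos hA hμA) measureReal_nonneg
  have hνpos : ∀ {S : Set G}, IsCompact S → 0 < μ S → 0 < ν.real S := fun hS hμS ↦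
    pos_of_mul_pos_right (hpos hS hμS) hk₀
  have hνzero : ∀ {S : Set G}, IsCompact S → μ S = 0 → ν S = 0 := fun {S} hS hμS ↦ by
    have h := hk S hS
    rw [setIntegral_measure_zero _ hμS, eq_comm, mul_eq_zero, or_iff_right hkpos.ne',
      measureReal_eq_zero_iff hS.measure_lt_top.ne] at h
    exact h
  have hμreal : ∀ {S : Set G}, IsCompact S → 0 < μ.real S → 0 < μ S := fun _ h ↦
    (ENNReal.toReal_pos_iff.mp h).1
  have hνlevel : ∀ {K : Set G}, IsCompact K → ∀ c, ν (K ∩ Δ ⁻¹' {c}) = 0 := fun {K} hK c ↦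
    hνzero (hK.inter_right (isClosed_singleton.preimage hΔc)) (hlevel hK c)
  have hνA := hνpos hA hμA
  have hμB' : 0 < μ.real B := ENNReal.toReal_pos hμB.ne' hB.measure_lt_top.ne
  -- Each set is halved for the measure in its own numerator.
  obtain ⟨a, ha₁, ha₂⟩ := exists_measureReal_level_eq_half ν hΔc hA (hνlevel hA)
  obtain ⟨b, hb₁, hb₂⟩ := exists_measureReal_level_eq_half μ hΔc hB (hlevel hB)
  have hle : ∀ c, IsClosed {x | Δ x ≤ c} := fun c ↦ isClosed_le hΔc continuous_const
  have hge : ∀ c, IsClosed {x | c ≤ Δ x} := fun c ↦ isClosed_le continuous_const hΔc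
  have hA₁ := hA.inter_right (hle a)
  have hA₂ := hA.inter_right (hge a)
  have hB₁ := hB.inter_right (hle b)
  have hB₂ := hB.inter_right (hge b)
  have hAB := hA.mul hB
  have hAB₁ := hA₁.mul hB₁
  have hAB₂ := hA₂.mul hB₂
  have hsub₁ : (A ∩ {x | Δ x ≤ a}) * (B ∩ {x | Δ x ≤ b}) ⊆ A * B :=
    mul_subset_mul inter_subset_left inter_subset_left
  have hsub₂ : (A ∩ {x | a ≤ Δ x}) * (B ∩ {x | b ≤ Δ x}) ⊆ A * B :=
    mul_subset_mul inter_subset_left inter_subset_left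
  have hνA₁ : 0 < ν.real (A ∩ {x | Δ x ≤ a}) := by rw [ha₁]; linarith
  have hνA₂ : 0 < ν.real (A ∩ {x | a ≤ Δ x}) := by rw [ha₂]; linarith
  have hμB₁ : 0 < μ.real (B ∩ {x | Δ x ≤ b}) := by rw [hb₁]; linarith
  have hμB₂ : 0 < μ.real (B ∩ {x | b ≤ Δ x}) := by rw [hb₂]; linarith
  have hBM₁ := hBM _ _ hA₁ hB₁ (ENNReal.toReal_pos_iff.mp hνA₁).1 (hμreal hB₁ hμB₁)
  have hBM₂ := hBM _ _ hA₂ hB₂ (ENNReal.toReal_pos_iff.mp hνA₂).1 (hμreal hB₂ hμB₂)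
  rw [ha₁, hb₁] at hBM₁
  rw [ha₂, hb₂] at hBM₂
  have hmulpos : ∀ {S T : Set G}, IsCompact S → IsCompact T → 0 < ν.real S → 0 < μ.real T →
      0 < μ (S * T) := by
    intro S T hS hT hνS hμT
    obtain ⟨x, hx⟩ : S.Nonempty := nonempty_of_measureReal_ne_zero hνS.ne'
    refine (hμreal hT hμT).trans_le ?_
    rw [← measure_preimage_mul μ x⁻¹ T]
    exact measure_mono fun y hy ↦ ⟨x, hx, x⁻¹ * y, hy, mul_inv_cancel_left x y⟩
  have hμ₁ := hmulpos hA₁ hB₁ hνA₁ hμB₁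
  have hμ₂ := hmulpos hA₂ hB₂ hνA₂ hμB₂
  have hΔ₁ : ∀ z ∈ (A ∩ {x | Δ x ≤ a}) * (B ∩ {x | Δ x ≤ b}), Δ z ≤ a * b := by
    rintro _ ⟨x, hx, y, hy, rfl⟩
    simp only [hΔmul]
    exact mul_le_mul hx.2 hy.2 (hΔpos y).le ((hΔpos x).le.trans hx.2)
  have hb₀ : 0 ≤ b := by
    obtain ⟨y, hy⟩ := nonempty_of_measureReal_ne_zero hμB₁.ne'
    exact (hΔpos y).le.trans hy.2
  have hΔ₂ : ∀ z ∈ (A ∩ {x | a ≤ Δ x}) * (B ∩ {x | b ≤ Δ x}), a * b ≤ Δ z := by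
    rintro _ ⟨x, hx, y, hy, rfl⟩
    simp only [hΔmul]
    exact mul_le_mul hx.2 hy.2 hb₀ (hΔpos x).le
  set P := (A ∩ {x | Δ x ≤ a}) * (B ∩ {x | Δ x ≤ b})
  set Q := (A ∩ {x | a ≤ Δ x}) * (B ∩ {x | b ≤ Δ x})
  -- With `hk`, these become `k ν(P) < ab μ(P)` and `ab μ(Q) < k ν(Q)`, which exclude the equality
  -- case.
  have hlt₁ := setIntegral_lt_mul_measureReal hΔc hAB₁ (hlevel hAB₁ _) hμ₁.ne' hΔ₁
  have hlt₂ := mul_measureReal_lt_setIntegral hΔc hAB₂ (hlevel hAB₂ _) hμ₂.ne' hΔ₂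
  rw [hk P hAB₁] at hlt₁
  rw [hk Q hAB₂] at hlt₂
  have hinter : P ∩ Q ⊆ P ∩ Δ ⁻¹' {a * b} := fun z hz ↦
    ⟨hz.1, le_antisymm (hΔ₁ z hz.1) (hΔ₂ z hz.2)⟩
  have hadd : ∀ m : Measure G, IsFiniteMeasureOnCompacts m → m (P ∩ Δ ⁻¹' {a * b}) = 0 →
      m.real P + m.real Q ≤ m.real (A * B) := by
    intro m _ hm
    rw [← measureReal_union_add_inter hAB₂.measurableSet hAB₁.measure_lt_top.ne
      hAB₂.measure_lt_top.ne, measureReal_def m (P ∩ Q), measure_mono_null hinter hm,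
      ENNReal.toReal_zero, add_zero]
    exact measureReal_mono (union_subset hsub₁ hsub₂) hAB.measure_lt_top.ne
  refine sqrt_div_add_sqrt_div_lt_one hνA hμB' (hνpos hAB₁ hμ₁) (hνpos hAB₂ hμ₂)
    (ENNReal.toReal_pos hμ₁.ne' hAB₁.measure_lt_top.ne)
    (ENNReal.toReal_pos hμ₂.ne' hAB₂.measure_lt_top.ne)
    (hadd ν inferInstance (hνlevel hAB₁ _)) (hadd μ inferInstance (hlevel hAB₁ _)) hBM₁ hBM₂ ?_
  rintro ⟨h, h'⟩
  replace h' : μ.real P = μ.real Q := h'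
  rw [h, h'] at hlt₁
  linarith

end BrunnMinkowski

theorem proposition6p1 {G : Type*} [Group G] [TopologicalSpace G] [IsTopologicalGroup G]
    [T2Space G] [LocallyCompactSpace G] [ConnectedSpace G] [MeasurableSpace G] [BorelSpace G]
    -- a left Haar measure
    (μ : Measure G) [μ.IsHaarMeasure]
    -- a right Haar measure
    (ν : Measure G) [ν.IsMulRightInvariant] [IsFiniteMeasureOnCompacts ν] [ν.IsOpenPosMeasure]
    -- `G` is not unimodular
    (hG : ¬ μ.IsMulRightInvariant)
    (hBM : IsGroupBMCoeff μ ν 2)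
    (A : Set G) (hA : IsCompact A) (hpos : 0 < μ A) :
    (ν.real A / ν.real (A * A)) ^ (1 / 2 : ℝ) + (μ.real A / μ.real (A * A)) ^ (1 / 2 : ℝ) < 1 := by
  have hpair : ∀ A B : Set G, IsCompact A → IsCompact B → 0 < ν A → 0 < μ B →
      √(ν.real A / ν.real (A * B)) + √(μ.real B / μ.real (A * B)) ≤ 1 := by
    intro A B hA hB hνA hμB
    obtain ⟨t, ht, hst⟩ := hBM.1.2 A B hA hB hνA hμB
    rw [Real.sqrt_eq_rpow, Real.sqrt_eq_rpow]
    exact ht.rpow_add_rpow_le_one hA hB (nonempty_of_measure_ne_zero hνA.ne')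
      (nonempty_of_measure_ne_zero hμB.ne') two_pos hst
  rw [← Real.sqrt_eq_rpow, ← Real.sqrt_eq_rpow]
  exact sqrt_add_sqrt_lt_one_of_not_isMulRightInvariant μ ν hG hpair hA hA hpos hpos
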